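/- For $n\ge 1$ let $$B_n=\langle \sigma_1,\dots,\sigma_{n-1}\mid \sigma_i\sigma_j=\sigma_j\sigma_i\ (|i-j|\ge 2),\ \sigma_i\sigma_j\sigma_i=\sigma_j\sigma_i\sigma_j\ (|i-j|=1)\rangle$$ be the braid group on $n$ strands. Put $\delta=\sigma_{n-1}\sigma_{n-2}\cdots\sigma_1$ and $U_j=(\sigma_{j-1}\cdots\sigma_2\sigma_1)(\sigma_1\sigma_2\cdots\sigma_{j-1})$ for $2\le j\le n$. The induced permutation of braids is the homomorphism $\beta\mapsto\pi_\beta$ from $B_n$ to the permutations of $\{1,\dots,n\}$ (with $(\pi_1\circ\pi_2)(i)=\pi_1(\pi_2(i))$) that sends $\sigma_i$ to the transposition of $i$ and $i+1$. A permutation braid is a braid that is represented by a positive word in the $\sigma_i$ in whose diagram no pair of strands crosses more than once. **Theorem.** Let $n$ and $k$ be coprime integers with $2\le k\le n-1$, and let $a_i=\lceil ni/k\rceil$ for $1\le i\le k-1$. Then the $n$-braid $\delta^k$ is conjugate in $B_n$ to $\delta\,U_{a_1}U_{a_2}\cdots U_{a_{k-1}}$. More precisely, let $\pi_k$ be the permutation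 of $\{1,\dots,n\}$ with $\pi_k(i)\equiv ki \pmod n$ for $1\le i\le n$. There is a unique permutation braid $X_k\in B_n$ whose induced permutation is $\pi_k$, and $$X_k^{-1}\,\delta^k\,X_k=\delta\,U_{a_1}U_{a_2}\cdots U_{a_{k-1}}.$$ -/

import Mathlib

/-- The indices `1, …, n - 1` of the standard generators of the braid group on `n` strands. -/
abbrev BraidGen (n : ℕ) : Type := {i : ℕ // i ∈ Finset.Ico 1 n}

/-- The endpoints `1, …, n` of the strands of an `n`-braid. -/
abbrev BraidPt (n : ℕ) : Type := {i : ℕ // i ∈ Finset.Icc 1 n}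

/-- The Artin relators: `σ_i σ_j = σ_j σ_i` when the indices differ by at least `2`, and
`σ_i σ_j σ_i = σ_j σ_i σ_j` when they differ by `1` (each unordered pair is listed once). -/
def braidRels (n : ℕ) : Set (FreeGroup (BraidGen n)) :=
  {r | ∃ i j : BraidGen n, i.1 + 2 ≤ j.1 ∧
      r = FreeGroup.of i * FreeGroup.of j * (FreeGroup.of j * FreeGroup.of i)⁻¹} ∪
  {r | ∃ i j : BraidGen n, i.1 + 1 = j.1 ∧
      r = FreeGroup.of i * FreeGroup.of j * FreeGroup.of i *
        (FreeGroup.of j * FreeGroup.of i * FreeGroup.of j)⁻¹}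

/-- The braid group `B_n`, by its Artin presentation. -/
abbrev BraidGroup (n : ℕ) : Type := PresentedGroup (braidRels n)

/-- The standard generator `σ_i` of `B_n` for `1 ≤ i ≤ n - 1` (and `1` for other `i`). -/
def braidSigma (n i : ℕ) : BraidGroup n :=
  if h : i ∈ Finset.Ico 1 n then PresentedGroup.of ⟨i, h⟩ else 1

/-- `D_j = σ_{j-1} ⋯ σ_2 σ_1` in `B_n`. -/
def braidD (n j : ℕ) : BraidGroup n :=
  ((List.range' 1 (j - 1)).reverse.map (braidSigma n)).prod

/-- `E_j = σ_1 σ_2 ⋯ σ_{j-1}` in `B_n`. -/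
def braidE (n j : ℕ) : BraidGroup n :=
  ((List.range' 1 (j - 1)).map (braidSigma n)).prod

/-- `U_j = (σ_{j-1} ⋯ σ_1)(σ_1 ⋯ σ_{j-1})` in `B_n`. -/
def braidU (n j : ℕ) : BraidGroup n := braidD n j * braidE n j

/-- `δ = σ_{n-1} ⋯ σ_2 σ_1` in `B_n`. -/
def braidDelta (n : ℕ) : BraidGroup n := braidD n n

/-- The transposition of the endpoints `i` and `i + 1`. -/
def adjSwap {n : ℕ} (i : BraidGen n) : Equiv.Perm (BraidPt n) :=
  Equiv.swap
    ⟨i.1, Finset.mem_Icc.2 ⟨(Finset.mem_Ico.1 i.2).1, (Finset.mem_Ico.1 i.2).2.le⟩⟩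
    ⟨i.1 + 1, Finset.mem_Icc.2 ⟨Nat.succ_pos _, (Finset.mem_Ico.1 i.2).2⟩⟩

theorem adjSwap_val {n : ℕ} (i : BraidGen n) (p : BraidPt n) :
    (adjSwap i p).1 = if p.1 = i.1 then i.1 + 1 else if p.1 = i.1 + 1 then i.1 else p.1 := by
  unfold adjSwap
  rw [Equiv.swap_apply_def]
  simp only [Subtype.ext_iff]
  split_ifs <;> rfl

theorem adjSwap_rels (n : ℕ) :
    ∀ r ∈ braidRels n, FreeGroup.lift (fun i : BraidGen n => adjSwap i) r = 1 := by
  rintro r (⟨i, j, hij, rfl⟩ | ⟨i, j, hij, rfl⟩)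
  · simp only [map_mul, map_inv, FreeGroup.lift_apply_of]
    rw [mul_inv_eq_one]
    ext p
    simp only [Equiv.Perm.mul_apply, adjSwap_val]
    grind
  · simp only [map_mul, map_inv, FreeGroup.lift_apply_of]
    rw [mul_inv_eq_one]
    ext p
    simp only [Equiv.Perm.mul_apply, adjSwap_val]
    grind

/-- The induced permutation `π_β`, sending `i` to the left endpoint of the strand of `β` whose
right endpoint is `i` (braids are drawn from left to right). It satisfies
`π_{αβ} = π_α ∘ π_β`, and `π_{σ_i}` exchanges `i` and `i + 1`. -/
def inducedPerm (n : ℕ) : BraidGroup n →* Equiv.Perm (BraidPt n) :=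
  PresentedGroup.toGroup (f := fun i : BraidGen n => adjSwap i) (adjSwap_rels n)

/-- The crossings of the positive diagram of the word `σ_{i_1} σ_{i_2} ⋯`, read from left to right,
each recorded as the unordered pair of the strands that cross there; a strand is named by its left
endpoint. The first letter `σ_i` crosses the strands `i` and `i + 1`, and the strand that starts at
the point `p` to the right of that crossing is the strand `adjSwap i p` of the whole diagram. -/
def wordCrossings {n : ℕ} : List (BraidGen n) → List (Sym2 (BraidPt n))
  | [] => []
  | i :: w =>
      s(⟨i.1, Finset.mem_Icc.2 ⟨(Finset.mem_Ico.1 i.2).1, (Finset.mem_Ico.1 i.2).2.le⟩⟩,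
        ⟨i.1 + 1, Finset.mem_Icc.2 ⟨Nat.succ_pos _, (Finset.mem_Ico.1 i.2).2⟩⟩) ::
      (wordCrossings w).map (Sym2.map (adjSwap i))

/-- A permutation braid: a positive braid in which no pair of strands crosses more than once. -/
def IsPermutationBraid {n : ℕ} (β : BraidGroup n) : Prop :=
  ∃ w : List (BraidGen n),
    β = (w.map fun i => (PresentedGroup.of i : BraidGroup n)).prod ∧ (wordCrossings w).Nodup

/-- The representative in `{1, …, n}` of the residue class of `k * i` modulo `n`. -/
def mulRep (n k : ℕ) (i : BraidPt n) : BraidPt n :=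
  ⟨if k * i.1 % n = 0 then n else k * i.1 % n, by
    have hi := Finset.mem_Icc.1 i.2
    have hlt := Nat.mod_lt (k * i.1) (show 0 < n by omega)
    rw [Finset.mem_Icc]
    split_ifs <;> omega⟩

theorem mulRep_modEq (n k : ℕ) (i : BraidPt n) : (mulRep n k i).1 ≡ k * i.1 [MOD n] := by
  unfold mulRep Nat.ModEq
  dsimp only
  split_ifs with h
  · rw [Nat.mod_self, h]
  · exact Nat.mod_mod _ _

theorem mulRep_bijective {n k : ℕ} (h : n.Coprime k) : Function.Bijective (mulRep n k) := by
  rw [← Finite.injective_iff_bijective]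
  intro i j hij
  have hmod : k * i.1 ≡ k * j.1 [MOD n] :=
    (mulRep_modEq n k i).symm.trans (hij ▸ mulRep_modEq n k j)
  have hmod' : i.1 ≡ j.1 [MOD n] := Nat.ModEq.cancel_left_of_coprime h hmod
  have hi := Finset.mem_Icc.1 i.2
  have hj := Finset.mem_Icc.1 j.2
  apply Subtype.ext
  rcases le_total i.1 j.1 with hle | hle
  · have hd := (Nat.modEq_iff_dvd' hle).1 hmod'
    have := Nat.eq_zero_of_dvd_of_lt hd (by omega)
    omega
  · have hd := (Nat.modEq_iff_dvd' hle).1 hmod'.symm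
    have := Nat.eq_zero_of_dvd_of_lt hd (by omega)
    omega

/-- The `n`-permutation `π_k` with `π_k(i) ≡ k i` modulo `n`, for `k` coprime to `n`. -/
noncomputable def mulPerm {n k : ℕ} (h : n.Coprime k) : Equiv.Perm (BraidPt n) :=
  Equiv.ofBijective (mulRep n k) (mulRep_bijective h)

/-- `a_i = ⌈n i / k⌉`. -/
def ceilIndex (n k i : ℕ) : ℕ := ⌈((n : ℚ) * i / k)⌉₊

/-- `δ U_{a_1} ⋯ U_{a_{k-1}}` in `B_n`, where `a_i = ⌈n i / k⌉`. -/
def deltaUProd (n k : ℕ) : BraidGroup n :=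
  braidDelta n * ((List.range' 1 (k - 1)).map fun i => braidU n (ceilIndex n k i)).prod

/-!
Write `P π` for the permutation braid of `π` and `ρ` for the permutation of `δ`. Then
`P (π * τ) = P π * P τ` whenever no two strands cross in both factors. If `b = π⁻¹ 1`, splitting
`E_b` off the right end of `P π` leaves a permutation braid in which the strand at `1` crosses no
other. Multiplying it by `δ` yields a permutation braid again, and `D_b` splits off its right end;
hence `δ * P π = P (ρ * π) * D_b * E_b = P (ρ * π) * U_b`, for every `π`. Iterating,
`δ ^ k * P π` is `P (ρ ^ k * π)` times the product of the `U_b` with `b = (ρ ^ m * π)⁻¹ 1`, `m < k`.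

For `π = π_k` one has `ρ ^ k * π = π * ρ`, and `P (π * ρ) = P π * δ` because `π` fixes `n`. The
indices `b` that occur are the numbers `⌊n i / k⌋ + 1` with `i < k`, in the order of decreasing
`n i mod k`. They can be rearranged since the `U_j` commute with one another; `i = 0` contributes
`U_1 = 1`, and `i ≥ 1` contributes `U_{a_i}`.
-/

section Strands

variable {n : ℕ}

theorem BraidPt.eq_of_modEq {x y : BraidPt n} (h : x.1 ≡ y.1 [MOD n]) : x = y := by
  have hx := Finset.mem_Icc.1 x.2
  have hy := Finset.mem_Icc.1 y.2
  exact Subtype.ext (h.eq_of_abs_lt (abs_lt.2 (by omega)))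

namespace BraidGen

/-- The left point `i` of the pair of endpoints `i`, `i + 1` exchanged by `σ_i`. -/
def left (p : BraidGen n) : BraidPt n :=
  ⟨p.1, Finset.mem_Icc.2 ⟨(Finset.mem_Ico.1 p.2).1, (Finset.mem_Ico.1 p.2).2.le⟩⟩

/-- The right point `i + 1` of the pair of endpoints `i`, `i + 1` exchanged by `σ_i`. -/
def right (p : BraidGen n) : BraidPt n :=
  ⟨p.1 + 1, Finset.mem_Icc.2 ⟨Nat.succ_pos _, (Finset.mem_Ico.1 p.2).2⟩⟩

theorem left_val (p : BraidGen n) : p.left.1 = p.1 := rfl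

theorem right_val (p : BraidGen n) : p.right.1 = p.1 + 1 := rfl

theorem left_lt_right (p : BraidGen n) : p.left < p.right :=
  Nat.lt_succ_self p.1

theorem exists_of_covBy {i j : BraidPt n} (h : i ⋖ j) :
    ∃ p : BraidGen n, p.left = i ∧ p.right = j := by
  have hij : i.1 < j.1 := h.lt
  have hi := Finset.mem_Icc.1 i.2
  have hj := Finset.mem_Icc.1 j.2
  refine ⟨⟨i.1, Finset.mem_Ico.2 (by omega)⟩, rfl, Subtype.ext (le_antisymm hij ?_)⟩
  by_contra! hlt
  exact h.2 (c := ⟨i.1 + 1, Finset.mem_Icc.2 (by omega)⟩) (Nat.lt_succ_self i.1) hlt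

end BraidGen

theorem adjSwap_left (p : BraidGen n) : adjSwap p p.left = p.right :=
  Equiv.swap_apply_left _ _

theorem adjSwap_right (p : BraidGen n) : adjSwap p p.right = p.left :=
  Equiv.swap_apply_right _ _

theorem adjSwap_of_ne {p : BraidGen n} {x : BraidPt n} (hl : x ≠ p.left) (hr : x ≠ p.right) :
    adjSwap p x = x :=
  Equiv.swap_apply_of_ne_of_ne hl hr

theorem adjSwap_mul_self (p : BraidGen n) : adjSwap p * adjSwap p = 1 :=
  Equiv.swap_mul_self _ _

theorem adjSwap_adjSwap (p : BraidGen n) (x : BraidPt n) : adjSwap p (adjSwap p x) = x :=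
  Equiv.swap_apply_self _ _ _

theorem adjSwap_lt_adjSwap {p : BraidGen n} {i j : BraidPt n} (hij : i < j)
    (hne : ¬(i = p.left ∧ j = p.right)) : adjSwap p i < adjSwap p j := by
  simp only [BraidGen.left, BraidGen.right, Subtype.ext_iff] at hne
  rw [← Subtype.coe_lt_coe] at hij ⊢
  rw [adjSwap_val, adjSwap_val]
  split_ifs <;> omega

/-- The generator `σ_i` is a right descent of `π` if `π (i + 1) < π i`: the strands of the
permutation braid of `π` that end at `i` and `i + 1` cross. -/
def IsRightDescent (π : Equiv.Perm (BraidPt n)) (p : BraidGen n) : Prop :=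
  π p.right < π p.left

theorem isRightDescent_mul_adjSwap {π : Equiv.Perm (BraidPt n)} {p : BraidGen n} :
    IsRightDescent (π * adjSwap p) p ↔ π p.left < π p.right := by
  rw [IsRightDescent, Equiv.Perm.mul_apply, Equiv.Perm.mul_apply, adjSwap_left, adjSwap_right]

theorem not_isRightDescent {π : Equiv.Perm (BraidPt n)} {p : BraidGen n} :
    ¬IsRightDescent π p ↔ π p.left < π p.right := by
  rw [IsRightDescent, not_lt, (π.injective.ne p.left_lt_right.ne).le_iff_lt]

theorem exists_isRightDescent {π : Equiv.Perm (BraidPt n)} (h : π ≠ 1) :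
    ∃ p, IsRightDescent π p := by
  contrapose! h
  have hmono : StrictMono π := (strictMono_iff_forall_covBy π).2 fun i j hij => by
    obtain ⟨p, rfl, rfl⟩ := BraidGen.exists_of_covBy hij
    exact not_isRightDescent.1 (h p)
  exact Equiv.ext fun x => hmono.apply_eq

/-- The inversions of a permutation of the endpoints. -/
def inversions (π : Equiv.Perm (BraidPt n)) : Finset (BraidPt n × BraidPt n) :=
  {x | x.1 < x.2 ∧ π x.2 < π x.1}

theorem mem_inversions {π : Equiv.Perm (BraidPt n)} {i j : BraidPt n} :
    (i, j) ∈ inversions π ↔ i < j ∧ π j < π i := by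
  simp [inversions]

theorem IsRightDescent.card_inversions_lt {π : Equiv.Perm (BraidPt n)} {p : BraidGen n}
    (h : IsRightDescent π p) : (inversions (π * adjSwap p)).card < (inversions π).card := by
  refine lt_of_le_of_lt (Finset.card_le_card_of_injOn (Prod.map (adjSwap p) (adjSwap p)) ?_
    ((adjSwap p).injective.prodMap (adjSwap p).injective).injOn)
    (Finset.card_erase_lt_of_mem (a := (p.left, p.right)) (mem_inversions.2 ⟨p.left_lt_right, h⟩))
  rintro ⟨x, y⟩ hxy
  obtain ⟨hlt, hinv⟩ := mem_inversions.1 hxy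
  refine Finset.mem_erase.2 ⟨fun heq => ?_, mem_inversions.2 ⟨adjSwap_lt_adjSwap hlt ?_, hinv⟩⟩
  · obtain ⟨hx, hy⟩ := Prod.mk.inj heq
    rw [← adjSwap_right, (adjSwap p).apply_eq_iff_eq] at hx
    rw [← adjSwap_left, (adjSwap p).apply_eq_iff_eq] at hy
    exact lt_asymm p.left_lt_right (hx ▸ hy ▸ hlt)
  · rintro ⟨rfl, rfl⟩
    exact lt_asymm h (isRightDescent_mul_adjSwap.1 hinv)

@[elab_as_elim]
theorem adjSwap_induction_on {motive : Equiv.Perm (BraidPt n) → Prop} (π : Equiv.Perm (BraidPt n))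
    (one : motive 1)
    (mul_adjSwap : ∀ π p, π p.left < π p.right → motive π → motive (π * adjSwap p)) : motive π := by
  by_cases h : π = 1
  · exact h ▸ one
  · obtain ⟨p, hp⟩ := exists_isRightDescent h
    have hπ : π * adjSwap p * adjSwap p = π := by rw [mul_assoc, adjSwap_mul_self, mul_one]
    have hlt := isRightDescent_mul_adjSwap.1 (hπ.symm ▸ hp)
    exact hπ ▸ mul_adjSwap _ p hlt (adjSwap_induction_on _ one mul_adjSwap)
termination_by (inversions π).card
decreasing_by exact hp.card_inversions_lt

/-- `LengthAdditive π τ` says that the length (number of inversions) of `π * τ` is the sum of those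
of `π` and `τ`: two strands that cross in the permutation braid of `τ` do not cross again in that
of `π`. -/
def LengthAdditive (π τ : Equiv.Perm (BraidPt n)) : Prop :=
  ∀ i j, i < j → τ j < τ i → π (τ j) < π (τ i)

theorem LengthAdditive.lt_of_mul_adjSwap {π τ : Equiv.Perm (BraidPt n)} {p : BraidGen n}
    (h : LengthAdditive π (τ * adjSwap p)) (hp : τ p.left < τ p.right) :
    (π * τ) p.left < (π * τ) p.right := by
  simpa only [Equiv.Perm.mul_apply, adjSwap_left, adjSwap_right] using
    h _ _ p.left_lt_right (isRightDescent_mul_adjSwap.2 hp)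

theorem LengthAdditive.of_mul_adjSwap {π τ : Equiv.Perm (BraidPt n)} {p : BraidGen n}
    (h : LengthAdditive π (τ * adjSwap p)) (hp : τ p.left < τ p.right) : LengthAdditive π τ := by
  intro i j hij hτ
  have hne : ¬(i = p.left ∧ j = p.right) := by
    rintro ⟨rfl, rfl⟩
    exact lt_asymm hp hτ
  have key := h _ _ (adjSwap_lt_adjSwap hij hne)
  simp only [Equiv.Perm.mul_apply, adjSwap_adjSwap] at key
  exact key hτ

theorem braidSigma_coe (p : BraidGen n) : braidSigma n p = PresentedGroup.of p :=
  dif_pos p.2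

theorem inducedPerm_braidSigma (p : BraidGen n) : inducedPerm n (braidSigma n p) = adjSwap p := by
  rw [braidSigma_coe, inducedPerm, PresentedGroup.toGroup.of]

theorem braidSigma_commute {i j : ℕ} (h : i + 2 ≤ j) :
    Commute (braidSigma n i) (braidSigma n j) := by
  by_cases hi : i ∈ Finset.Ico 1 n
  · by_cases hj : j ∈ Finset.Ico 1 n
    · rw [braidSigma, braidSigma, dif_pos hi, dif_pos hj]
      exact mul_inv_eq_one.1
        (PresentedGroup.one_of_mem (rels := braidRels n) (Or.inl ⟨⟨i, hi⟩, ⟨j, hj⟩, h, rfl⟩))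
    · rw [braidSigma, braidSigma, dif_neg hj]
      exact Commute.one_right _
  · rw [braidSigma, dif_neg hi]
    exact Commute.one_left _

theorem braidSigma_braid {i : ℕ} (h1 : 1 ≤ i) (hn : i + 1 < n) :
    braidSigma n i * braidSigma n (i + 1) * braidSigma n i =
      braidSigma n (i + 1) * braidSigma n i * braidSigma n (i + 1) := by
  have hi : i ∈ Finset.Ico 1 n := Finset.mem_Ico.2 (by omega)
  have hi' : i + 1 ∈ Finset.Ico 1 n := Finset.mem_Ico.2 (by omega)
  rw [braidSigma, braidSigma, dif_pos hi, dif_pos hi']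
  exact mul_inv_eq_one.1
    (PresentedGroup.one_of_mem (rels := braidRels n) (Or.inr ⟨⟨i, hi⟩, ⟨i + 1, hi'⟩, rfl, rfl⟩))

open Classical in
/-- The permutation braid with a given induced permutation, as the product of the generators met
when right descents are removed one by one. Which descents are chosen does not matter, by
`IsRightDescent.permBraid_eq`. -/
noncomputable def permBraid (π : Equiv.Perm (BraidPt n)) : BraidGroup n :=
  if h : ∃ p, IsRightDescent π p then
    permBraid (π * adjSwap h.choose) * braidSigma n h.choose
  else 1
termination_by (inversions π).card
decreasing_by exact h.choose_spec.card_inversions_lt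

theorem permBraid_one : permBraid (1 : Equiv.Perm (BraidPt n)) = 1 := by
  rw [permBraid, dif_neg]
  rintro ⟨p, hp⟩
  exact lt_asymm p.left_lt_right hp

section Confluence

variable {π : Equiv.Perm (BraidPt n)} {p q : BraidGen n}

theorem isRightDescent_mul_adjSwap_of_far (h : p.1 + 2 ≤ q.1 ∨ q.1 + 2 ≤ p.1) :
    IsRightDescent (π * adjSwap p) q ↔ IsRightDescent π q := by
  have hl : adjSwap p q.left = q.left := by
    apply adjSwap_of_ne <;> simp only [BraidGen.left, BraidGen.right, Ne, Subtype.ext_iff] <;> omega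
  have hr : adjSwap p q.right = q.right := by
    apply adjSwap_of_ne <;> simp only [BraidGen.left, BraidGen.right, Ne, Subtype.ext_iff] <;> omega
  rw [IsRightDescent, Equiv.Perm.mul_apply, Equiv.Perm.mul_apply, hl, hr, IsRightDescent]

theorem permBraid_mul_braidSigma_of_far
    (ih : ∀ τ : Equiv.Perm (BraidPt n), (inversions τ).card < (inversions π).card →
      ∀ r, IsRightDescent τ r → permBraid τ = permBraid (τ * adjSwap r) * braidSigma n r)
    (hp : IsRightDescent π p) (hq : IsRightDescent π q) (h : p.1 + 2 ≤ q.1) :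
    permBraid (π * adjSwap p) * braidSigma n p = permBraid (π * adjSwap q) * braidSigma n q := by
  have hcomm : adjSwap p * adjSwap q = adjSwap q * adjSwap p := by
    simpa only [map_mul, inducedPerm_braidSigma] using
      congrArg (inducedPerm n) (braidSigma_commute h).eq
  rw [ih _ hp.card_inversions_lt q ((isRightDescent_mul_adjSwap_of_far (.inl h)).2 hq),
    ih _ hq.card_inversions_lt p ((isRightDescent_mul_adjSwap_of_far (.inr h)).2 hp),
    mul_assoc π, hcomm, ← mul_assoc π, mul_assoc, ← (braidSigma_commute h).eq, ← mul_assoc]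

theorem permBraid_mul_braidSigma_of_adjacent
    (ih : ∀ τ : Equiv.Perm (BraidPt n), (inversions τ).card < (inversions π).card →
      ∀ r, IsRightDescent τ r → permBraid τ = permBraid (τ * adjSwap r) * braidSigma n r)
    (hp : IsRightDescent π p) (hq : IsRightDescent π q) (h : p.1 + 1 = q.1) :
    permBraid (π * adjSwap p) * braidSigma n p = permBraid (π * adjSwap q) * braidSigma n q := by
  have hpq : p.right = q.left := Subtype.ext h
  have hpl : adjSwap q p.left = p.left :=
    adjSwap_of_ne (hpq ▸ p.left_lt_right.ne) (p.left_lt_right.trans (hpq ▸ q.left_lt_right)).ne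
  have hqr : adjSwap p q.right = q.right :=
    adjSwap_of_ne (p.left_lt_right.trans (hpq ▸ q.left_lt_right)).ne' (hpq ▸ q.left_lt_right.ne')
  have hbraid : braidSigma n p * braidSigma n q * braidSigma n p =
      braidSigma n q * braidSigma n p * braidSigma n q := by
    rw [← h]
    exact braidSigma_braid (Finset.mem_Ico.1 p.2).1 (h ▸ (Finset.mem_Ico.1 q.2).2)
  have hswap : adjSwap p * adjSwap q * adjSwap p = adjSwap q * adjSwap p * adjSwap q := by
    simpa only [map_mul, inducedPerm_braidSigma] using congrArg (inducedPerm n) hbraid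
  have hp_q : IsRightDescent (π * adjSwap p) q := by
    rw [IsRightDescent, Equiv.Perm.mul_apply, Equiv.Perm.mul_apply, hqr, ← hpq, adjSwap_right]
    exact lt_trans hq (hpq ▸ hp)
  have hq_p : IsRightDescent (π * adjSwap q) p := by
    rw [IsRightDescent, Equiv.Perm.mul_apply, Equiv.Perm.mul_apply, hpl, hpq, adjSwap_left]
    exact lt_trans hq (hpq ▸ hp)
  have hpq_p : IsRightDescent (π * adjSwap p * adjSwap q) p := by
    have hlt : π q.right < π p.right := by rwa [hpq]
    simpa only [IsRightDescent, Equiv.Perm.mul_apply, hpl, hpq, adjSwap_left, hqr] using hlt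
  have hqp_q : IsRightDescent (π * adjSwap q * adjSwap p) q := by
    simpa only [IsRightDescent, Equiv.Perm.mul_apply, hqr, ← hpq, adjSwap_right, hpl] using hp
  rw [ih _ hp.card_inversions_lt q hp_q, ih _ hq.card_inversions_lt p hq_p,
    ih _ (hp_q.card_inversions_lt.trans hp.card_inversions_lt) p hpq_p,
    ih _ (hq_p.card_inversions_lt.trans hq.card_inversions_lt) q hqp_q]
  calc permBraid (π * adjSwap p * adjSwap q * adjSwap p) * braidSigma n p * braidSigma n q *
        braidSigma n p
      = permBraid (π * (adjSwap p * adjSwap q * adjSwap p)) *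
          (braidSigma n p * braidSigma n q * braidSigma n p) := by simp only [mul_assoc]
    _ = permBraid (π * (adjSwap q * adjSwap p * adjSwap q)) *
          (braidSigma n q * braidSigma n p * braidSigma n q) := by rw [hswap, hbraid]
    _ = _ := by simp only [mul_assoc]

end Confluence

theorem IsRightDescent.permBraid_eq {π : Equiv.Perm (BraidPt n)} {p : BraidGen n}
    (hp : IsRightDescent π p) : permBraid π = permBraid (π * adjSwap p) * braidSigma n p := by
  have ih : ∀ τ : Equiv.Perm (BraidPt n), (inversions τ).card < (inversions π).card →
      ∀ r, IsRightDescent τ r → permBraid τ = permBraid (τ * adjSwap r) * braidSigma n r :=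
    fun τ _ r hr => hr.permBraid_eq
  have hex : ∃ q, IsRightDescent π q := ⟨p, hp⟩
  have hq := hex.choose_spec
  rw [permBraid, dif_pos hex]
  generalize hex.choose = q at hq
  rcases lt_trichotomy p.1 q.1 with hlt | heq | hgt
  · rcases (Nat.succ_le_of_lt hlt).eq_or_lt with h | h
    · exact (permBraid_mul_braidSigma_of_adjacent ih hp hq h).symm
    · exact (permBraid_mul_braidSigma_of_far ih hp hq h).symm
  · rw [Subtype.ext heq]
  · rcases (Nat.succ_le_of_lt hgt).eq_or_lt with h | h
    · exact permBraid_mul_braidSigma_of_adjacent ih hq hp h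
    · exact permBraid_mul_braidSigma_of_far ih hq hp h
termination_by (inversions π).card

theorem permBraid_mul_adjSwap {π : Equiv.Perm (BraidPt n)} {p : BraidGen n}
    (h : π p.left < π p.right) : permBraid (π * adjSwap p) = permBraid π * braidSigma n p := by
  rw [(isRightDescent_mul_adjSwap.2 h).permBraid_eq, mul_assoc, adjSwap_mul_self, mul_one]

theorem permBraid_adjSwap (p : BraidGen n) : permBraid (adjSwap p) = braidSigma n p := by
  simpa only [one_mul, permBraid_one] using permBraid_mul_adjSwap (π := 1) p.left_lt_right

theorem permBraid_mul {π τ : Equiv.Perm (BraidPt n)} (h : LengthAdditive π τ) :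
    permBraid (π * τ) = permBraid π * permBraid τ := by
  induction τ using adjSwap_induction_on with
  | one => rw [mul_one, permBraid_one, mul_one]
  | mul_adjSwap τ p hp ih =>
    rw [permBraid_mul_adjSwap hp, ← mul_assoc, ← mul_assoc, ← ih (h.of_mul_adjSwap hp),
      permBraid_mul_adjSwap (h.lt_of_mul_adjSwap hp)]

theorem inducedPerm_permBraid (π : Equiv.Perm (BraidPt n)) : inducedPerm n (permBraid π) = π := by
  induction π using adjSwap_induction_on with
  | one => rw [permBraid_one, map_one]
  | mul_adjSwap π p hp ih => rw [permBraid_mul_adjSwap hp, map_mul, ih, inducedPerm_braidSigma]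

/-- The braid represented by a positive word. -/
def wordBraid (w : List (BraidGen n)) : BraidGroup n :=
  (w.map fun i => (PresentedGroup.of i : BraidGroup n)).prod

theorem wordBraid_concat (w : List (BraidGen n)) (p : BraidGen n) :
    wordBraid (w ++ [p]) = wordBraid w * braidSigma n p := by
  rw [wordBraid, List.map_append, List.prod_append, List.map_singleton, List.prod_singleton,
    wordBraid, braidSigma_coe]

theorem wordCrossings_concat (w : List (BraidGen n)) (p : BraidGen n) :
    wordCrossings (w ++ [p]) = wordCrossings w ++
      [s(inducedPerm n (wordBraid w) p.left, inducedPerm n (wordBraid w) p.right)] := by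
  induction w with
  | nil => simp [wordCrossings, wordBraid, BraidGen.left, BraidGen.right]
  | cons q w ih =>
    simp only [List.cons_append, wordCrossings, ih, List.map_append, List.map_cons, List.map_nil,
      Sym2.map_mk, wordBraid, List.prod_cons, map_mul, ← braidSigma_coe, inducedPerm_braidSigma,
      Equiv.Perm.mul_apply]

theorem nodup_wordCrossings_concat {w : List (BraidGen n)} {p : BraidGen n} :
    (wordCrossings (w ++ [p])).Nodup ↔ (wordCrossings w).Nodup ∧
      s(inducedPerm n (wordBraid w) p.left, inducedPerm n (wordBraid w) p.right) ∉
        wordCrossings w := by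
  rw [wordCrossings_concat, ← List.concat_eq_append, List.nodup_concat, and_comm]

theorem mem_wordCrossings_iff {w : List (BraidGen n)} (hw : (wordCrossings w).Nodup)
    {i j : BraidPt n} (hij : i < j) :
    s(inducedPerm n (wordBraid w) i, inducedPerm n (wordBraid w) j) ∈ wordCrossings w ↔
      inducedPerm n (wordBraid w) j < inducedPerm n (wordBraid w) i := by
  induction w using List.reverseRecOn generalizing i j with
  | nil => simpa [wordCrossings, wordBraid] using hij.le
  | append_singleton w p ih =>
    obtain ⟨hw, hnew⟩ := nodup_wordCrossings_concat.1 hw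
    have hp : inducedPerm n (wordBraid w) p.left < inducedPerm n (wordBraid w) p.right :=
      not_isRightDescent.1 fun h => hnew ((ih hw p.left_lt_right).2 h)
    rw [wordCrossings_concat, wordBraid_concat, map_mul, inducedPerm_braidSigma,
      Equiv.Perm.mul_apply, Equiv.Perm.mul_apply, List.mem_append, List.mem_singleton]
    by_cases hpair : i = p.left ∧ j = p.right
    · rw [hpair.1, hpair.2, adjSwap_left, adjSwap_right]
      exact iff_of_true (.inr Sym2.eq_swap) hp
    · have hlt : adjSwap p i < adjSwap p j := adjSwap_lt_adjSwap hij hpair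
      rw [ih hw hlt, or_iff_left]
      intro heq
      rcases Sym2.eq_iff.1 heq with ⟨hi, hj⟩ | ⟨hi, hj⟩ <;>
        rw [EmbeddingLike.apply_eq_iff_eq] at hi hj
      · rw [← adjSwap_adjSwap p i, ← adjSwap_adjSwap p j, hi, hj, adjSwap_left,
          adjSwap_right] at hij
        exact lt_asymm p.left_lt_right hij
      · rw [hi, hj] at hlt
        exact lt_asymm p.left_lt_right hlt

theorem nodup_wordCrossings_concat_iff_lt {w : List (BraidGen n)} {p : BraidGen n} :
    (wordCrossings (w ++ [p])).Nodup ↔ (wordCrossings w).Nodup ∧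
      inducedPerm n (wordBraid w) p.left < inducedPerm n (wordBraid w) p.right := by
  rw [nodup_wordCrossings_concat]
  refine and_congr_right fun hw => ?_
  rw [mem_wordCrossings_iff hw p.left_lt_right]
  exact not_isRightDescent

theorem permBraid_inducedPerm_wordBraid {w : List (BraidGen n)} (hw : (wordCrossings w).Nodup) :
    permBraid (inducedPerm n (wordBraid w)) = wordBraid w := by
  induction w using List.reverseRecOn with
  | nil => rw [wordBraid, List.map_nil, List.prod_nil, map_one, permBraid_one]
  | append_singleton w p ih =>
    obtain ⟨hw, hp⟩ := nodup_wordCrossings_concat_iff_lt.1 hw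
    rw [wordBraid_concat, map_mul, inducedPerm_braidSigma, permBraid_mul_adjSwap hp, ih hw]

theorem isPermutationBraid_permBraid (π : Equiv.Perm (BraidPt n)) :
    IsPermutationBraid (permBraid π) := by
  induction π using adjSwap_induction_on with
  | one => exact ⟨[], permBraid_one, List.nodup_nil⟩
  | mul_adjSwap π p hp ih =>
    obtain ⟨w, hπ, hw⟩ := ih
    have hw_perm : inducedPerm n (wordBraid w) = π := by
      rw [wordBraid, ← hπ, inducedPerm_permBraid]
    refine ⟨w ++ [p], ?_, nodup_wordCrossings_concat_iff_lt.2 ⟨hw, by rwa [hw_perm]⟩⟩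
    rw [permBraid_mul_adjSwap hp, hπ]
    exact (wordBraid_concat w p).symm

theorem isPermutationBraid_and_inducedPerm_eq_iff {X : BraidGroup n}
    {π : Equiv.Perm (BraidPt n)} :
    IsPermutationBraid X ∧ inducedPerm n X = π ↔ X = permBraid π := by
  constructor
  · rintro ⟨⟨w, rfl, hw⟩, rfl⟩
    exact (permBraid_inducedPerm_wordBraid hw).symm
  · rintro rfl
    exact ⟨isPermutationBraid_permBraid π, inducedPerm_permBraid π⟩

section CyclicBraids

variable {i j : ℕ}

theorem braidE_one : braidE n 1 = 1 := rfl

theorem braidD_one : braidD n 1 = 1 := rfl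

theorem braidE_succ (hj : 1 ≤ j) : braidE n (j + 1) = braidE n j * braidSigma n j := by
  rw [braidE, braidE, Nat.sub_add_comm hj, List.range'_1_concat, List.map_append,
    List.prod_append, List.map_singleton, List.prod_singleton, Nat.add_sub_cancel' hj]

theorem braidD_succ (hj : 1 ≤ j) : braidD n (j + 1) = braidSigma n j * braidD n j := by
  rw [braidD, braidD, Nat.sub_add_comm hj, List.range'_1_concat, List.reverse_concat,
    List.map_cons, List.prod_cons, Nat.add_sub_cancel' hj]

theorem braidE_commute_of_forall {x : BraidGroup n}
    (h : ∀ i, 1 ≤ i → i < j → Commute (braidSigma n i) x) : Commute (braidE n j) x := by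
  refine Commute.list_prod_left _ _ fun y hy => ?_
  obtain ⟨i, hi, rfl⟩ := List.mem_map.1 hy
  rw [List.mem_range'_1] at hi
  exact h i hi.1 (by omega)

theorem braidD_commute_of_forall {x : BraidGroup n}
    (h : ∀ i, 1 ≤ i → i < j → Commute (braidSigma n i) x) : Commute (braidD n j) x := by
  refine Commute.list_prod_left _ _ fun y hy => ?_
  obtain ⟨i, hi, rfl⟩ := List.mem_map.1 hy
  rw [List.mem_reverse, List.mem_range'_1] at hi
  exact h i hi.1 (by omega)

theorem braidU_commute_of_forall {x : BraidGroup n}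
    (h : ∀ i, 1 ≤ i → i < j → Commute (braidSigma n i) x) : Commute (braidU n j) x :=
  (braidD_commute_of_forall h).mul_left (braidE_commute_of_forall h)

theorem braidE_semiconjBy (hi : 1 ≤ i) (hij : i + 2 ≤ j) (hj : j ≤ n) :
    SemiconjBy (braidE n j) (braidSigma n i) (braidSigma n (i + 1)) := by
  induction j, hij using Nat.le_induction with
  | base =>
    rw [braidE_succ (by omega), braidE_succ hi, mul_assoc]
    refine SemiconjBy.mul_left
      (braidE_commute_of_forall fun m _ hm => braidSigma_commute (by omega)) ?_
    rw [SemiconjBy, braidSigma_braid hi (by omega), mul_assoc]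
  | succ j hij ih =>
    rw [braidE_succ (by omega)]
    exact (ih (by omega)).mul_left (braidSigma_commute hij).symm

theorem braidD_semiconjBy (hi : 1 ≤ i) (hij : i + 2 ≤ j) (hj : j ≤ n) :
    SemiconjBy (braidD n j) (braidSigma n (i + 1)) (braidSigma n i) := by
  induction j, hij using Nat.le_induction with
  | base =>
    rw [braidD_succ (by omega), braidD_succ hi, ← mul_assoc]
    refine SemiconjBy.mul_left ?_
      (braidD_commute_of_forall fun m _ hm => braidSigma_commute (by omega))
    rw [SemiconjBy, ← braidSigma_braid hi (by omega), mul_assoc]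
  | succ j hij ih =>
    rw [braidD_succ (by omega)]
    exact SemiconjBy.mul_left (braidSigma_commute hij).symm (ih (by omega))

theorem braidU_commute_braidSigma (hi : 1 ≤ i) (hij : i + 2 ≤ j) (hj : j ≤ n) :
    Commute (braidU n j) (braidSigma n i) :=
  (braidD_semiconjBy hi hij hj).mul_left (braidE_semiconjBy hi hij hj)

theorem braidU_commute_braidU (hi : i ≤ n) (hj : j ≤ n) :
    Commute (braidU n i) (braidU n j) := by
  wlog h : i ≤ j generalizing i j
  · exact (this hj hi (le_of_not_ge h)).symm
  rcases h.eq_or_lt with rfl | hij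
  · exact Commute.refl _
  · exact braidU_commute_of_forall fun m hm hmi =>
      (braidU_commute_braidSigma hm (by omega) hj).symm

theorem inducedPerm_braidE_val (hj : 1 ≤ j) (hjn : j ≤ n) (x : BraidPt n) :
    (inducedPerm n (braidE n j) x).1 = if x.1 = j then 1 else if x.1 < j then x.1 + 1 else x.1 := by
  have hx := Finset.mem_Icc.1 x.2
  induction j, hj using Nat.le_induction generalizing x with
  | base =>
    rw [braidE_one, map_one, Equiv.Perm.one_apply]
    split_ifs <;> omega
  | succ j hj ih =>
    obtain ⟨p, rfl⟩ : ∃ p : BraidGen n, p.1 = j := ⟨⟨j, Finset.mem_Ico.2 ⟨hj, hjn⟩⟩, rfl⟩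
    rw [braidE_succ hj, map_mul, inducedPerm_braidSigma, Equiv.Perm.mul_apply,
      ih (by omega) _ (Finset.mem_Icc.1 (adjSwap p x).2), adjSwap_val]
    split_ifs <;> omega

theorem inducedPerm_braidD (hj : 1 ≤ j) (hjn : j ≤ n) :
    inducedPerm n (braidD n j) = (inducedPerm n (braidE n j))⁻¹ := by
  induction j, hj using Nat.le_induction with
  | base => rw [braidD_one, braidE_one, map_one, inv_one]
  | succ j hj ih =>
    obtain ⟨p, rfl⟩ : ∃ p : BraidGen n, p.1 = j := ⟨⟨j, Finset.mem_Ico.2 ⟨hj, hjn⟩⟩, rfl⟩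
    rw [braidE_succ hj, braidD_succ hj, map_mul, map_mul, inducedPerm_braidSigma, ih (by omega),
      mul_inv_rev, ← mul_eq_one_iff_eq_inv.1 (adjSwap_mul_self p)]

theorem inducedPerm_braidD_val (hj : 1 ≤ j) (hjn : j ≤ n) (x : BraidPt n) :
    (inducedPerm n (braidD n j) x).1 = if x.1 = 1 then j else if x.1 ≤ j then x.1 - 1 else x.1 := by
  have hx := Finset.mem_Icc.1 x.2
  obtain ⟨y, rfl⟩ := (inducedPerm n (braidE n j)).surjective x
  have hy := Finset.mem_Icc.1 y.2
  rw [inducedPerm_braidD hj hjn, ← Equiv.Perm.mul_apply, inv_mul_cancel, Equiv.Perm.one_apply,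
    inducedPerm_braidE_val hj hjn]
  split_ifs <;> omega

theorem permBraid_inducedPerm_braidE (hj : 1 ≤ j) (hjn : j ≤ n) :
    permBraid (inducedPerm n (braidE n j)) = braidE n j := by
  induction j, hj using Nat.le_induction with
  | base => rw [braidE_one, map_one, permBraid_one]
  | succ j hj ih =>
    obtain ⟨p, rfl⟩ : ∃ p : BraidGen n, p.1 = j := ⟨⟨j, Finset.mem_Ico.2 ⟨hj, hjn⟩⟩, rfl⟩
    have hp : inducedPerm n (braidE n p) p.left < inducedPerm n (braidE n p) p.right := by
      rw [← Subtype.coe_lt_coe, inducedPerm_braidE_val hj (by omega),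
        inducedPerm_braidE_val hj (by omega), p.left_val, p.right_val, if_pos rfl]
      grind
    rw [braidE_succ hj, map_mul, inducedPerm_braidSigma, permBraid_mul_adjSwap hp, ih (by omega)]

theorem permBraid_inducedPerm_braidD (hj : 1 ≤ j) (hjn : j ≤ n) :
    permBraid (inducedPerm n (braidD n j)) = braidD n j := by
  induction j, hj using Nat.le_induction with
  | base => rw [braidD_one, map_one, permBraid_one]
  | succ j hj ih =>
    obtain ⟨p, rfl⟩ : ∃ p : BraidGen n, p.1 = j := ⟨⟨j, Finset.mem_Ico.2 ⟨hj, hjn⟩⟩, rfl⟩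
    have hadd : LengthAdditive (adjSwap p) (inducedPerm n (braidD n p)) := by
      intro x y hxy hinv
      have hx := Finset.mem_Icc.1 x.2
      rw [← Subtype.coe_lt_coe] at hxy hinv ⊢
      rw [inducedPerm_braidD_val hj (by omega), inducedPerm_braidD_val hj (by omega)] at hinv
      rw [adjSwap_val, adjSwap_val, inducedPerm_braidD_val hj (by omega),
        inducedPerm_braidD_val hj (by omega)]
      split_ifs at hinv ⊢ <;> omega
    rw [braidD_succ hj, map_mul, inducedPerm_braidSigma, permBraid_mul hadd, ih (by omega),
      permBraid_adjSwap]

end CyclicBraids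

theorem permBraid_inducedPerm_braidDelta (hn : 1 ≤ n) :
    permBraid (inducedPerm n (braidDelta n)) = braidDelta n :=
  permBraid_inducedPerm_braidD hn le_rfl

theorem inducedPerm_braidDelta_val (x : BraidPt n) :
    (inducedPerm n (braidDelta n) x).1 = if x.1 = 1 then n else x.1 - 1 := by
  have hx := Finset.mem_Icc.1 x.2
  rw [braidDelta, inducedPerm_braidD_val (hx.1.trans hx.2) le_rfl, if_pos hx.2]

theorem lengthAdditive_mul_inv {π c : Equiv.Perm (BraidPt n)} :
    LengthAdditive (π * c⁻¹) c ↔ ∀ i j, i < j → c j < c i → π j < π i := by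
  simp only [LengthAdditive, ← Equiv.Perm.mul_apply, inv_mul_cancel_right]

theorem lengthAdditive_inducedPerm_braidE {π : Equiv.Perm (BraidPt n)} {b : BraidPt n}
    (hb : (π b).1 = 1) :
    LengthAdditive (π * (inducedPerm n (braidE n b))⁻¹) (inducedPerm n (braidE n b)) := by
  refine lengthAdditive_mul_inv.2 fun i j hij hinv => ?_
  have hbn := Finset.mem_Icc.1 b.2
  have hjb : j = b := by
    rw [← Subtype.coe_lt_coe] at hij hinv
    rw [inducedPerm_braidE_val hbn.1 hbn.2, inducedPerm_braidE_val hbn.1 hbn.2] at hinv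
    refine Subtype.ext ?_
    split_ifs at hinv <;> omega
  have hle : π j ≤ π i := by
    rw [← Subtype.coe_le_coe, hjb, hb]
    exact (Finset.mem_Icc.1 (π i).2).1
  exact hle.lt_of_ne (π.injective.ne hij.ne')

theorem lengthAdditive_inducedPerm_braidDelta {π : Equiv.Perm (BraidPt n)}
    (h : ∀ x : BraidPt n, x.1 = 1 → (π x).1 = 1) :
    LengthAdditive (inducedPerm n (braidDelta n)) π := by
  intro i j hij hinv
  have hi := Finset.mem_Icc.1 i.2
  have hj : (π j).1 ≠ 1 := fun hj => by
    let x : BraidPt n := ⟨1, Finset.mem_Icc.2 ⟨le_rfl, hi.1.trans hi.2⟩⟩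
    have hjx : j = x := π.injective (Subtype.ext (hj.trans (h x rfl).symm))
    exact hij.not_ge (hjx ▸ hi.1)
  have hπj := Finset.mem_Icc.1 (π j).2
  rw [← Subtype.coe_lt_coe] at hinv ⊢
  rw [inducedPerm_braidDelta_val, inducedPerm_braidDelta_val, if_neg hj, if_neg (by omega)]
  omega

theorem lengthAdditive_inducedPerm_braidD {π : Equiv.Perm (BraidPt n)} {b : BraidPt n}
    (hb : (π b).1 = n) : LengthAdditive π (inducedPerm n (braidD n b)) := by
  intro i j hij hinv
  have hbn := Finset.mem_Icc.1 b.2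
  have hib : inducedPerm n (braidD n b) i = b := by
    have hi := Finset.mem_Icc.1 i.2
    rw [← Subtype.coe_lt_coe] at hij hinv
    rw [inducedPerm_braidD_val hbn.1 hbn.2, inducedPerm_braidD_val hbn.1 hbn.2] at hinv
    refine Subtype.ext ?_
    rw [inducedPerm_braidD_val hbn.1 hbn.2]
    split_ifs at hinv ⊢ <;> omega
  have hle : π (inducedPerm n (braidD n b) j) ≤ π (inducedPerm n (braidD n b) i) := by
    rw [← Subtype.coe_le_coe, hib, hb]
    exact (Finset.mem_Icc.1 (Subtype.prop _)).2
  exact hle.lt_of_ne (π.injective.ne hinv.ne)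

theorem braidDelta_mul_permBraid {π : Equiv.Perm (BraidPt n)} {b : BraidPt n}
    (hb : (π b).1 = 1) :
    braidDelta n * permBraid π =
      permBraid (inducedPerm n (braidDelta n) * π) * braidU n b := by
  have hbn := Finset.mem_Icc.1 b.2
  set ρ := inducedPerm n (braidDelta n) with hρ
  set c := inducedPerm n (braidE n b) with hc
  have hfix : ∀ x : BraidPt n, x.1 = 1 → ((π * c⁻¹) x).1 = 1 := by
    intro x hx
    have hcb : c b = x := Subtype.ext <| by
      rw [hx, hc, inducedPerm_braidE_val hbn.1 hbn.2, if_pos rfl]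
    rw [← hcb, ← Equiv.Perm.mul_apply, inv_mul_cancel_right, hb]
  have hlast : ((ρ * π) b).1 = n := by
    rw [Equiv.Perm.mul_apply, hρ, inducedPerm_braidDelta_val, if_pos hb]
  calc braidDelta n * permBraid π
      = braidDelta n * permBraid (π * c⁻¹ * c) := by rw [inv_mul_cancel_right]
    _ = permBraid (ρ * (π * c⁻¹)) * braidE n b := by
      rw [permBraid_mul (lengthAdditive_inducedPerm_braidE hb),
        permBraid_mul (lengthAdditive_inducedPerm_braidDelta hfix),
        permBraid_inducedPerm_braidE hbn.1 hbn.2,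
        permBraid_inducedPerm_braidDelta (hbn.1.trans hbn.2), mul_assoc]
    _ = permBraid (ρ * π) * braidU n b := by
      rw [← mul_assoc, hc, ← inducedPerm_braidD hbn.1 hbn.2,
        permBraid_mul (lengthAdditive_inducedPerm_braidD hlast),
        permBraid_inducedPerm_braidD hbn.1 hbn.2, mul_assoc, braidU]

theorem braidDelta_pow_mul_permBraid {π : Equiv.Perm (BraidPt n)} {b : ℕ → BraidPt n}
    (hb : ∀ m, ((inducedPerm n (braidDelta n) ^ m * π) (b m)).1 = 1) (k : ℕ) :
    braidDelta n ^ k * permBraid π = permBraid (inducedPerm n (braidDelta n) ^ k * π) *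
      ((List.range k).reverse.map fun m => braidU n (b m)).prod := by
  induction k with
  | zero => simp
  | succ k ih =>
    rw [pow_succ', mul_assoc, ih, ← mul_assoc, braidDelta_mul_permBraid (hb k), ← mul_assoc,
      ← pow_succ', List.range_succ, List.reverse_concat, List.map_cons, List.prod_cons, mul_assoc]

theorem inducedPerm_braidDelta_pow_modEq (m : ℕ) (x : BraidPt n) :
    ((inducedPerm n (braidDelta n) ^ m) x).1 + m ≡ x.1 [MOD n] := by
  induction m with
  | zero => rfl
  | succ m ih =>
    refine Nat.ModEq.trans ?_ ih
    rw [pow_succ', Equiv.Perm.mul_apply, inducedPerm_braidDelta_val, ← add_assoc,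
      add_right_comm]
    refine Nat.ModEq.add_right m ?_
    have hy := Finset.mem_Icc.1 ((inducedPerm n (braidDelta n) ^ m) x).2
    split_ifs with h
    · rw [h]
      exact Nat.add_modEq_left
    · rw [Nat.sub_add_cancel hy.1]

theorem map_range_perm_range {f : ℕ → ℕ} {k : ℕ} (hf : ∀ i < k, f i < k)
    (hinj : ∀ i < k, ∀ j < k, f i = f j → i = j) :
    ((List.range k).map f).Perm (List.range k) := by
  have hnodup : ((List.range k).map f).Nodup :=
    List.Nodup.map_on (fun i hi j hj => hinj i (List.mem_range.1 hi) j (List.mem_range.1 hj))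
      List.nodup_range
  refine (List.subperm_of_subset hnodup fun x hx => ?_).perm_of_length_le (by simp)
  obtain ⟨i, hi, rfl⟩ := List.mem_map.1 hx
  exact List.mem_range.2 (hf i (List.mem_range.1 hi))

section MulPerm

variable {k : ℕ}

theorem mulPerm_modEq (h : n.Coprime k) (x : BraidPt n) : (mulPerm h x).1 ≡ k * x.1 [MOD n] :=
  mulRep_modEq n k x

theorem mulPerm_val_of_eq (h : n.Coprime k) {x : BraidPt n} (hx : x.1 = n) :
    (mulPerm h x).1 = n := by
  have heq : mulPerm h x = x := BraidPt.eq_of_modEq <| (mulPerm_modEq h x).trans <| by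
    rw [hx, Nat.ModEq, Nat.mul_mod_left, Nat.mod_self]
  rw [heq, hx]

theorem inducedPerm_braidDelta_pow_mul_mulPerm (h : n.Coprime k) :
    inducedPerm n (braidDelta n) ^ k * mulPerm h = mulPerm h * inducedPerm n (braidDelta n) := by
  refine Equiv.ext fun x => BraidPt.eq_of_modEq (Nat.ModEq.add_right_cancel' k ?_)
  have hx : (inducedPerm n (braidDelta n) x).1 + 1 ≡ x.1 [MOD n] :=
    inducedPerm_braidDelta_pow_modEq 1 x
  calc ((inducedPerm n (braidDelta n) ^ k) (mulPerm h x)).1 + k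
      ≡ (mulPerm h x).1 [MOD n] := inducedPerm_braidDelta_pow_modEq k _
    _ ≡ k * x.1 [MOD n] := mulPerm_modEq h x
    _ ≡ k * ((inducedPerm n (braidDelta n) x).1 + 1) [MOD n] := (hx.mul_left k).symm
    _ ≡ (mulPerm h (inducedPerm n (braidDelta n) x)).1 + k [MOD n] :=
      ((mulPerm_modEq h _).add_right k).symm

theorem permBraid_mulPerm_mul (hn : 1 ≤ n) (h : n.Coprime k) :
    permBraid (mulPerm h * inducedPerm n (braidDelta n)) =
      permBraid (mulPerm h) * braidDelta n := by
  have hadd : LengthAdditive (mulPerm h) (inducedPerm n (braidDelta n)) :=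
    lengthAdditive_inducedPerm_braidD
      (mulPerm_val_of_eq h (x := ⟨n, Finset.mem_Icc.2 ⟨hn, le_rfl⟩⟩) rfl)
  rw [permBraid_mul hadd, permBraid_inducedPerm_braidDelta hn]

theorem inducedPerm_braidDelta_pow_mul_mulPerm_val (hk : 0 < k) (h : n.Coprime k) {i : ℕ}
    {x : BraidPt n} (hx : x.1 = n * i / k + 1) :
    ((inducedPerm n (braidDelta n) ^ (k - 1 - n * i % k) * mulPerm h) x).1 = 1 := by
  have hxn := Finset.mem_Icc.1 x.2
  have hr := Nat.mod_lt (n * i) hk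
  have hdiv := Nat.div_add_mod (n * i) k
  set y := (inducedPerm n (braidDelta n) ^ (k - 1 - n * i % k) * mulPerm h) x
  have hy : y.1 + (k - 1 - n * i % k) ≡ k * x.1 [MOD n] :=
    (inducedPerm_braidDelta_pow_modEq _ _).trans (mulPerm_modEq h x)
  have hone : y.1 ≡ 1 [MOD n] := Nat.ModEq.add_right_cancel' (k - 1) <|
    calc y.1 + (k - 1) = y.1 + (k - 1 - n * i % k) + n * i % k := by omega
      _ ≡ k * x.1 + n * i % k [MOD n] := hy.add_right _
      _ = n * i + (1 + (k - 1)) := by rw [hx, mul_add]; omega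
      _ ≡ 0 + (1 + (k - 1)) [MOD n] :=
        ((Nat.modEq_zero_iff_dvd).2 (dvd_mul_right n i)).add_right _
      _ = 1 + (k - 1) := zero_add _
  exact congrArg Subtype.val
    (BraidPt.eq_of_modEq (y := ⟨1, Finset.mem_Icc.2 ⟨le_rfl, hxn.1.trans hxn.2⟩⟩) hone)

theorem map_sub_mul_mod_perm_range (h : n.Coprime k) :
    ((List.range k).map fun i => k - 1 - n * i % k).Perm (List.range k) := by
  refine map_range_perm_range (fun i hi => by omega) fun i hi j hj hij => ?_
  have hri := Nat.mod_lt (n * i) (i.zero_le.trans_lt hi)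
  have hrj := Nat.mod_lt (n * j) (i.zero_le.trans_lt hi)
  have hmod : n * i ≡ n * j [MOD k] := by
    rw [Nat.ModEq]
    omega
  exact (Nat.ModEq.cancel_left_of_coprime h.symm hmod).eq_of_lt_of_lt hi hj

theorem mul_div_lt_of_lt (hn : 1 ≤ n) {i : ℕ} (hi : i < k) : n * i / k < n :=
  Nat.div_lt_of_lt_mul (by rw [mul_comm k]; exact Nat.mul_lt_mul_of_pos_left hi hn)

theorem braidDelta_pow_mul_permBraid_mulPerm (hn : 1 ≤ n) (hk : 0 < k) (h : n.Coprime k) :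
    braidDelta n ^ k * permBraid (mulPerm h) = permBraid (mulPerm h) *
      (braidDelta n * ((List.range k).map fun i => braidU n (n * i / k + 1)).prod) := by
  let first : BraidPt n := ⟨1, Finset.mem_Icc.2 ⟨le_rfl, hn⟩⟩
  let b : ℕ → BraidPt n := fun m => (inducedPerm n (braidDelta n) ^ m * mulPerm h)⁻¹ first
  have hb : ∀ m, ((inducedPerm n (braidDelta n) ^ m * mulPerm h) (b m)).1 = 1 := fun m =>
    congrArg Subtype.val (Equiv.Perm.eq_inv_iff_eq.1 rfl)
  have hstrand : ∀ i < k, (b (k - 1 - n * i % k)).1 = n * i / k + 1 := fun i hi => by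
    let x : BraidPt n := ⟨n * i / k + 1, Finset.mem_Icc.2 ⟨Nat.succ_pos _, mul_div_lt_of_lt hn hi⟩⟩
    have hx : x = b (k - 1 - n * i % k) := Equiv.Perm.eq_inv_iff_eq.2 <| Subtype.ext <|
      inducedPerm_braidDelta_pow_mul_mulPerm_val hk h rfl
    rw [← hx]
  have hperm : ((List.range k).reverse.map fun m => braidU n (b m)).Perm
      ((List.range k).map fun i => braidU n (n * i / k + 1)) := by
    have hmap := ((List.reverse_perm _).trans (map_sub_mul_mod_perm_range h).symm).map
      fun m => braidU n (b m)
    rw [List.map_map] at hmap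
    rwa [← List.map_congr_left fun i hi => congrArg (braidU n) (hstrand i (List.mem_range.1 hi))]
  have hcomm : ((List.range k).reverse.map fun m => braidU n (b m)).Pairwise Commute :=
    List.pairwise_map.2 <| List.pairwise_of_forall fun _ _ =>
      braidU_commute_braidU (Finset.mem_Icc.1 (b _).2).2 (Finset.mem_Icc.1 (b _).2).2
  rw [braidDelta_pow_mul_permBraid hb, inducedPerm_braidDelta_pow_mul_mulPerm,
    permBraid_mulPerm_mul hn, hperm.prod_eq' hcomm, mul_assoc]

theorem ceilIndex_of_not_dvd (hk : 0 < k) {i : ℕ} (h : ¬k ∣ n * i) :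
    ceilIndex n k i = n * i / k + 1 := by
  have hkQ : (0 : ℚ) < k := by exact_mod_cast hk
  have hdiv := Nat.div_add_mod' (n * i) k
  have hmod_lt := Nat.mod_lt (n * i) hk
  rw [ceilIndex, Nat.ceil_eq_iff (Nat.succ_ne_zero _), Nat.succ_sub_one, lt_div_iff₀ hkQ,
    div_le_iff₀ hkQ]
  constructor
  · exact_mod_cast (by omega : n * i / k * k < n * i)
  · exact_mod_cast (by rw [Nat.succ_mul]; omega : n * i ≤ (n * i / k + 1) * k)

theorem deltaUProd_eq (hk : 0 < k) (h : n.Coprime k) :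
    deltaUProd n k =
      braidDelta n * ((List.range k).map fun i => braidU n (n * i / k + 1)).prod := by
  have hone : braidU n 1 = 1 := mul_one 1
  obtain ⟨m, rfl⟩ := Nat.exists_eq_add_of_le' hk
  rw [deltaUProd, List.range_eq_range', List.range'_succ, List.map_cons, List.prod_cons, mul_zero,
    Nat.zero_div, zero_add, hone, one_mul, Nat.add_sub_cancel]
  congr 2
  refine List.map_congr_left fun i hi => ?_
  rw [List.mem_range'_1] at hi
  rw [ceilIndex_of_not_dvd hk fun hdvd =>
    Nat.not_dvd_of_pos_of_lt hi.1 (by omega) (h.symm.dvd_of_dvd_mul_left hdvd)]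

end MulPerm

end Strands

theorem mainTheorem3_general (n k : ℕ) (hn : 1 ≤ n) (hk : 1 ≤ k) (hcop : n.Coprime k) :
    IsConj (braidDelta n ^ k) (deltaUProd n k) ∧
    (∃! X : BraidGroup n, IsPermutationBraid X ∧ inducedPerm n X = mulPerm hcop) ∧
    (∀ X : BraidGroup n, IsPermutationBraid X → inducedPerm n X = mulPerm hcop →
      X⁻¹ * braidDelta n ^ k * X = deltaUProd n k) := by
  have hconj : braidDelta n ^ k * permBraid (mulPerm hcop) =
      permBraid (mulPerm hcop) * deltaUProd n k := by
    rw [deltaUProd_eq hk hcop, braidDelta_pow_mul_permBraid_mulPerm hn hk hcop]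
  refine ⟨(isConj_iff.2 ⟨permBraid (mulPerm hcop), ?_⟩).symm, ?_, fun X hX hπ => ?_⟩
  · rw [← hconj, mul_inv_cancel_right]
  · simp only [isPermutationBraid_and_inducedPerm_eq_iff, existsUnique_eq]
  · rw [isPermutationBraid_and_inducedPerm_eq_iff.1 ⟨hX, hπ⟩, mul_assoc, hconj,
      inv_mul_cancel_left]

theorem mainTheorem3 (n k : ℕ) (hcop : n.Coprime k) (hk : 2 ≤ k) (hkn : k ≤ n - 1) :
    IsConj (braidDelta n ^ k) (deltaUProd n k) ∧
    (∃! X : BraidGroup n, IsPermutationBraid X ∧ inducedPerm n X = mulPerm hcop) ∧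
    (∀ X : BraidGroup n, IsPermutationBraid X → inducedPerm n X = mulPerm hcop →
      X⁻¹ * braidDelta n ^ k * X = deltaUProd n k) :=
  mainTheorem3_general n k (by omega) (by omega) hcop
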